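/- Let $n\ge 1$ and let $\Gamma_{\mathrm{con}}$ be a connected simple graph on the qubits $\{1,\dots,n\}$. Let $\mathcal P^n=\{\mathrm i^q X^{\mathbf r}Z^{\mathbf r'} : q\in\{0,1,2,3\},\ \mathbf r,\mathbf r'\in\mathbb F_2^n\}$ be the $n$-qubit Pauli group, where $X^{\mathbf r}=X^{r_1}\otimes\cdots\otimes X^{r_n}$ and likewise for $Z$, and let $\mathcal C^n$ be the $n$-qubit Clifford group, the normalizer of $\mathcal P^n$ in the group of unitaries on $(\mathbb C^2)^{\otimes n}$. A unitary $V$ is said to be represented by $A=\begin{bmatrix}A^{xx}&A^{xz}\\A^{zx}&A^{zz}\end{bmatrix}\in\operatorname{Sp}(\mathbb F_2^{2n})$ if $VX^{\mathbf r}Z^{\mathbf r'}V^\dagger\propto X^{A^{xx}\mathbf r+A^{xz}\mathbf r'}Z^{A^{zx}\mathbf r+A^{zz}\mathbf r'}$ for all $\mathbf r,\mathbf r'\in\mathbb F_2^n$. A single-qubit Clifford layer is a unitary $c_1\otimes\cdots\otimes c_n$ with all $c_j\in\mathcal C^1$. For a simple graph $\Gamma$ on the qubits, the CZ layer of $\Gamma$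 is the product of the gates $CZ_{ij}$ over all edges $\{i,j\}$ of $\Gamma$. Then for every $U\in\mathcal C^n$ there are $l\ge 0$, graphs $\Gamma_1,\dots,\Gamma_l$ on the qubits, all of whose edges are edges of $\Gamma_{\mathrm{con}}$, single-qubit Clifford layers $V_1,\dots,V_{l+1}$, and the CZ layers $W_1,\dots,W_l$ of $\Gamma_1,\dots,\Gamma_l$, such that $$U=V_{l+1}W_lV_l\cdots W_1V_1 .$$ Here each $V_i$ is represented by a matrix $B_i\in\operatorname{Sp}(\mathbb F_2^{2n})$ whose four $n\times n$ blocks are diagonal, the $j$-th diagonal entries being those of a matrix in $\operatorname{Sp}(\mathbb F_2^2)$ that represents the $j$-th single-qubit gate of $V_i$, and each $W_i$ is represented by $G_i=\begin{bmatrix}\mathbb 1&0\\ \Gamma_i&\mathbb 1\end{bmatrix}\in\operatorname{Sp}(\mathbb F_2^{2n})$, where $\Gamma_i$ also denotes the adjacency matrix over $\mathbb F_2$. -/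

import Mathlib

open Matrix

noncomputable section

/-- Unitaries on `n` qubits; the computational basis is indexed by bit strings `Fin n → Fin 2`. -/
abbrev QubitUnitary (n : ℕ) := Matrix.unitaryGroup (Fin n → Fin 2) ℂ

/-- The symplectic group of `2n × 2n` matrices over the field with two elements. -/
abbrev BinarySp (n : ℕ) := Matrix.symplecticGroup (Fin n) (ZMod 2)

/-- The tensor product `M 0 ⊗ ⋯ ⊗ M (n-1)` of single-qubit operators. -/
def qubitTensor {n : ℕ} (M : Fin n → Matrix (Fin 2) (Fin 2) ℂ) :
    Matrix (Fin n → Fin 2) (Fin n → Fin 2) ℂ :=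
  Matrix.of fun s t => ∏ i, M i (s i) (t i)

/-- The single-qubit Pauli matrix `X`. -/
def pauliX : Matrix (Fin 2) (Fin 2) ℂ := !![0, 1; 1, 0]

/-- The single-qubit Pauli matrix `Z`. -/
def pauliZ : Matrix (Fin 2) (Fin 2) ℂ := !![1, 0; 0, -1]

/-- `X^r = X^{r_1} ⊗ ⋯ ⊗ X^{r_n}`. -/
def xString {n : ℕ} (r : Fin n → ZMod 2) : Matrix (Fin n → Fin 2) (Fin n → Fin 2) ℂ :=
  qubitTensor fun i => pauliX ^ (r i).val

/-- `Z^r = Z^{r_1} ⊗ ⋯ ⊗ Z^{r_n}`. -/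
def zString {n : ℕ} (r : Fin n → ZMod 2) : Matrix (Fin n → Fin 2) (Fin n → Fin 2) ℂ :=
  qubitTensor fun i => pauliZ ^ (r i).val

/-- The `n`-qubit Pauli group `{i^q X^r Z^{r'}}`, as a set of unitaries. -/
def pauliGroup (n : ℕ) : Set (QubitUnitary n) :=
  {P | ∃ (q : Fin 4) (r r' : Fin n → ZMod 2),
    (P : Matrix (Fin n → Fin 2) (Fin n → Fin 2) ℂ) =
      Complex.I ^ (q : ℕ) • (xString r * zString r')}

/-- The `n`-qubit Clifford group: the normalizer of the Pauli group in the unitary group. -/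
def cliffordGroup (n : ℕ) : Subgroup (QubitUnitary n) :=
  Subgroup.normalizer (pauliGroup n)

/-- `U` is mapped to `A` by the symplectic representation: `U X^r Z^{r'} U†` is proportional to
`X^{Axx r + Axz r'} Z^{Azx r + Azz r'}` for all `r`, `r'`. -/
def Represents {n : ℕ} (U : QubitUnitary n) (A : BinarySp n) : Prop :=
  ∀ r r' : Fin n → ZMod 2, ∃ c : ℂ,
    (U : Matrix (Fin n → Fin 2) (Fin n → Fin 2) ℂ) * (xString r * zString r') *
        (U : Matrix (Fin n → Fin 2) (Fin n → Fin 2) ℂ)ᴴ =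
      c • (xString (A.1.toBlocks₁₁ *ᵥ r + A.1.toBlocks₁₂ *ᵥ r') *
        zString (A.1.toBlocks₂₁ *ᵥ r + A.1.toBlocks₂₂ *ᵥ r'))

/-- A one-qubit unitary, with basis `Fin 1 → Fin 2`, as a `2 × 2` matrix. -/
def oneQubitMatrix (u : QubitUnitary 1) : Matrix (Fin 2) (Fin 2) ℂ :=
  Matrix.of fun a b => u.1 (fun _ => a) (fun _ => b)

/-- `V` is a layer of single-qubit Clifford gates with symplectic matrix `B`: there are one-qubit
Clifford gates `c j` with symplectic matrices `b j` such that `V = c 0 ⊗ ⋯ ⊗ c (n-1)`, the blocks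
of `B` are the diagonal matrices formed by the entries of the `b j`, and `V` is mapped to `B`. -/
def IsSCL {n : ℕ} (V : QubitUnitary n) (B : BinarySp n) : Prop :=
  Represents V B ∧
  ∃ (c : Fin n → QubitUnitary 1) (b : Fin n → BinarySp 1),
    (∀ j, c j ∈ cliffordGroup 1) ∧
    (∀ j, Represents (c j) (b j)) ∧
    (V : Matrix (Fin n → Fin 2) (Fin n → Fin 2) ℂ) = qubitTensor (fun j => oneQubitMatrix (c j)) ∧
    (B : Matrix (Fin n ⊕ Fin n) (Fin n ⊕ Fin n) (ZMod 2)) =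
      Matrix.fromBlocks
        (Matrix.diagonal fun j => (b j).1.toBlocks₁₁ 0 0)
        (Matrix.diagonal fun j => (b j).1.toBlocks₁₂ 0 0)
        (Matrix.diagonal fun j => (b j).1.toBlocks₂₁ 0 0)
        (Matrix.diagonal fun j => (b j).1.toBlocks₂₂ 0 0)

/-- The controlled-`Z` gate between qubits `i` and `j`. -/
def czGate {n : ℕ} (i j : Fin n) : Matrix (Fin n → Fin 2) (Fin n → Fin 2) ℂ :=
  Matrix.diagonal fun s => if s i = 1 ∧ s j = 1 then -1 else 1

theorem czGate_commute {n : ℕ} (i j k l : Fin n) : Commute (czGate i j) (czGate k l) := by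
  simp only [czGate, Commute, SemiconjBy, Matrix.diagonal_mul_diagonal, mul_comm]

open Classical in
/-- The product of the (commuting) gates `CZ_{ij}` over all edges `{i, j}` of `Γ`, each edge being
listed once, with `i < j`. -/
def czProduct {n : ℕ} (Γ : SimpleGraph (Fin n)) : Matrix (Fin n → Fin 2) (Fin n → Fin 2) ℂ :=
  (Finset.univ.filter fun p : Fin n × Fin n => p.1 < p.2 ∧ Γ.Adj p.1 p.2).noncommProd
    (fun p => czGate p.1 p.2) (fun _ _ _ _ _ => czGate_commute _ _ _ _)

open Classical in
/-- `W` is the layer of controlled-`Z` gates along the edges of `Γ`, and `W` is mapped to its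
symplectic matrix `G`, which has the blocks `1`, `0`, `Γ`, `1`. -/
def IsCZL {n : ℕ} (Γ : SimpleGraph (Fin n)) (W : QubitUnitary n) (G : BinarySp n) : Prop :=
  Represents W G ∧
  (W : Matrix (Fin n → Fin 2) (Fin n → Fin 2) ℂ) = czProduct Γ ∧
  (G : Matrix (Fin n ⊕ Fin n) (Fin n ⊕ Fin n) (ZMod 2)) =
    Matrix.fromBlocks 1 0 (Γ.adjMatrix (ZMod 2)) 1

/-- The alternating product `V l * (W (l-1) * V (l-1)) * ⋯ * (W 0 * V 0)`. -/
def alternatingProduct {n l : ℕ} (V : Fin (l + 1) → QubitUnitary n)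
    (W : Fin l → QubitUnitary n) : QubitUnitary n :=
  V (Fin.last l) * (List.ofFn fun i : Fin l => W i * V i.castSucc).reverse.prod

end

/-! Up to phases, Pauli operators are labelled by vectors over `ZMod 2`, and commutation signs give
a nondegenerate alternating form on labels. Conjugation by a Clifford unitary induces an isometry of
this form (`ActsAs.exists_isometry`), and over `ZMod 2` such isometries are products of
transvections (`mem_of_isometry`). It therefore suffices to realize every transvection by a circuit.

If `v` and `w` anticommute, the transvection along `v + w` is a conjugate of the one along `v` by
the one along `w` (`transvection_add_eq`), so the realizable labels are closed under sums of
anticommuting pairs. Single-qubit gates supply `X_j` and `Z_j`; a CZ with two phase gates supplies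
`Z_i + Z_j` on each edge. Connectedness of the graph then yields every nonzero label
(`mem_of_anticommuting_closed`).

Hence some circuit `C` acts on labels as `U` does, so `U * C⁻¹` fixes all labels and is a phase
times a Pauli operator (`ActsAs.exists_eq_smul_pauliOp`): one further single-qubit layer. Identity
layers make the circuit alternate. -/

noncomputable section

/-! ### Tensor products of one-qubit operators -/

section Tensor

variable {n : ℕ}

theorem qubitTensor_apply (M : Fin n → Matrix (Fin 2) (Fin 2) ℂ) (s t : Fin n → Fin 2) :
    qubitTensor M s t = ∏ i, M i (s i) (t i) := rfl

theorem qubitTensor_mul (M N : Fin n → Matrix (Fin 2) (Fin 2) ℂ) :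
    qubitTensor M * qubitTensor N = qubitTensor fun i => M i * N i := by
  ext s t
  simp only [Matrix.mul_apply, qubitTensor_apply, ← Finset.prod_mul_distrib]
  rw [Finset.prod_univ_sum, Fintype.piFinset_univ]

theorem qubitTensor_one : qubitTensor (fun _ : Fin n => (1 : Matrix (Fin 2) (Fin 2) ℂ)) = 1 := by
  ext s t
  simp only [qubitTensor_apply, Matrix.one_apply, Finset.prod_ite_zero, Finset.prod_const_one,
    funext_iff, Finset.mem_univ, forall_true_left]

theorem qubitTensor_smul (c : Fin n → ℂ) (M : Fin n → Matrix (Fin 2) (Fin 2) ℂ) :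
    qubitTensor (fun i => c i • M i) = (∏ i, c i) • qubitTensor M := by
  ext s t
  simp [qubitTensor_apply, Finset.prod_mul_distrib]

theorem qubitTensor_conjTranspose (M : Fin n → Matrix (Fin 2) (Fin 2) ℂ) :
    (qubitTensor M)ᴴ = qubitTensor fun i => (M i)ᴴ := by
  ext s t
  simp [qubitTensor_apply, Matrix.conjTranspose_apply]

theorem qubitTensor_mem_unitaryGroup {M : Fin n → Matrix (Fin 2) (Fin 2) ℂ}
    (hM : ∀ i, M i ∈ Matrix.unitaryGroup (Fin 2) ℂ) :
    qubitTensor M ∈ Matrix.unitaryGroup (Fin n → Fin 2) ℂ := by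
  rw [Matrix.mem_unitaryGroup_iff, Matrix.star_eq_conjTranspose, qubitTensor_conjTranspose,
    qubitTensor_mul, ← qubitTensor_one]
  congr 1
  funext i
  exact Matrix.mem_unitaryGroup_iff.1 (hM i)

end Tensor

/-! ### The sign character of `ZMod 2` -/

section Sign

/-- The nontrivial character of `ZMod 2`. -/
def binarySign (a : ZMod 2) : ℂ := (-1) ^ a.val

@[simp] theorem binarySign_zero : binarySign 0 = 1 := by simp [binarySign]

@[simp] theorem binarySign_one : binarySign 1 = -1 := by simp [binarySign, ZMod.val_one]

theorem zmod_two_eq_zero_or_one (a : ZMod 2) : a = 0 ∨ a = 1 := by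
  revert a; decide

theorem binarySign_add (a b : ZMod 2) : binarySign (a + b) = binarySign a * binarySign b := by
  have h : (1 + 1 : ZMod 2) = 0 := by decide
  rcases zmod_two_eq_zero_or_one a with rfl | rfl <;>
    rcases zmod_two_eq_zero_or_one b with rfl | rfl <;> simp [h]

theorem binarySign_sum {ι : Type*} (s : Finset ι) (f : ι → ZMod 2) :
    binarySign (∑ i ∈ s, f i) = ∏ i ∈ s, binarySign (f i) := by
  classical
  induction s using Finset.induction_on with
  | empty => simp
  | insert a s ha ih => rw [Finset.sum_insert ha, Finset.prod_insert ha, binarySign_add, ih]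

theorem binarySign_mul_self (a : ZMod 2) : binarySign a * binarySign a = 1 := by
  rcases zmod_two_eq_zero_or_one a with rfl | rfl <;> simp

theorem binarySign_ne_zero (a : ZMod 2) : binarySign a ≠ 0 := by
  rcases zmod_two_eq_zero_or_one a with rfl | rfl <;> simp

theorem binarySign_injective : Function.Injective binarySign := by
  have h : (1 : ℂ) ≠ -1 := by norm_num
  intro a b hab
  rcases zmod_two_eq_zero_or_one a with rfl | rfl <;>
    rcases zmod_two_eq_zero_or_one b with rfl | rfl <;> simp_all [eq_comm]

end Sign

/-! ### Pauli operators and the symplectic form on their labels -/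

section Pauli

/-- The one-qubit Pauli operator `X^a Z^b`. -/
def pauliOne (a : ZMod 2 × ZMod 2) : Matrix (Fin 2) (Fin 2) ℂ :=
  pauliX ^ a.1.val * pauliZ ^ a.2.val

@[simp] theorem pauliOne_zero_zero : pauliOne (0, 0) = 1 := by simp [pauliOne]

@[simp] theorem pauliOne_zero : pauliOne 0 = 1 := pauliOne_zero_zero

@[simp] theorem pauliOne_zero_one : pauliOne (0, 1) = !![1, 0; 0, -1] := by
  simp [pauliOne, pauliZ, ZMod.val_one]

@[simp] theorem pauliOne_one_zero : pauliOne (1, 0) = !![0, 1; 1, 0] := by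
  simp [pauliOne, pauliX, ZMod.val_one]

@[simp] theorem pauliOne_one_one : pauliOne (1, 1) = !![0, -1; 1, 0] := by
  simp [pauliOne, pauliX, pauliZ, ZMod.val_one]

/-- Case distinction over the four one-qubit Pauli operators. -/
theorem forall_pauliVec {p : ZMod 2 × ZMod 2 → Prop} :
    (∀ a, p a) ↔ p (0, 0) ∧ p (0, 1) ∧ p (1, 0) ∧ p (1, 1) := by
  refine ⟨fun h => ⟨h _, h _, h _, h _⟩, ?_⟩
  rintro ⟨h1, h2, h3, h4⟩ ⟨a, b⟩
  rcases zmod_two_eq_zero_or_one a with rfl | rfl <;>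
    rcases zmod_two_eq_zero_or_one b with rfl | rfl <;> assumption

/-- The sign comes from moving `Z^{a.2}` past `X^{b.1}`. -/
theorem pauliOne_mul (a b : ZMod 2 × ZMod 2) :
    pauliOne a * pauliOne b = binarySign (a.2 * b.1) • pauliOne (a + b) := by
  have h : (1 + 1 : ZMod 2) = 0 := by decide
  revert a b
  simp only [forall_pauliVec]
  simp [h, Matrix.one_fin_two]

theorem pauliOne_mem_unitaryGroup (a : ZMod 2 × ZMod 2) :
    pauliOne a ∈ Matrix.unitaryGroup (Fin 2) ℂ := by
  rw [Matrix.mem_unitaryGroup_iff, Matrix.star_eq_conjTranspose]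
  revert a
  simp only [forall_pauliVec]
  refine ⟨?_, ?_, ?_, ?_⟩ <;> ext i j <;> fin_cases i <;> fin_cases j <;>
    simp [Matrix.mul_apply]

variable {n : ℕ}

/-- The `n`-qubit Pauli operator `⊗ X^{a_i} Z^{b_i}`. -/
def pauliOp (v : Fin n → ZMod 2 × ZMod 2) : Matrix (Fin n → Fin 2) (Fin n → Fin 2) ℂ :=
  qubitTensor fun i => pauliOne (v i)

theorem xString_mul_zString (r r' : Fin n → ZMod 2) :
    xString r * zString r' = pauliOp fun i => (r i, r' i) := by
  rw [xString, zString, qubitTensor_mul]; rfl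

theorem pauliOp_eq_xString_mul_zString (v : Fin n → ZMod 2 × ZMod 2) :
    pauliOp v = xString (fun i => (v i).1) * zString fun i => (v i).2 := by
  rw [xString_mul_zString]

/-- The symplectic form on binary Pauli vectors. -/
def pauliForm (n : ℕ) : LinearMap.BilinForm (ZMod 2) (Fin n → ZMod 2 × ZMod 2) :=
  LinearMap.mk₂ (ZMod 2) (fun v w => ∑ i, ((v i).1 * (w i).2 + (v i).2 * (w i).1))
    (by intros; rw [← Finset.sum_add_distrib]; congr 1; funext i; simp; ring)
    (by intros; rw [smul_eq_mul, Finset.mul_sum]; congr 1; funext i; simp; ring)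
    (by intros; rw [← Finset.sum_add_distrib]; congr 1; funext i; simp; ring)
    (by intros; rw [smul_eq_mul, Finset.mul_sum]; congr 1; funext i; simp; ring)

theorem pauliForm_apply (v w : Fin n → ZMod 2 × ZMod 2) :
    pauliForm n v w = ∑ i, ((v i).1 * (w i).2 + (v i).2 * (w i).1) := rfl

theorem pauliForm_isAlt : (pauliForm n).IsAlt := by
  intro v
  rw [pauliForm_apply]
  refine Finset.sum_eq_zero fun i _ => ?_
  rw [mul_comm]
  exact CharTwo.add_self_eq_zero _

theorem pauliForm_single_right (v : Fin n → ZMod 2 × ZMod 2) (i : Fin n) (a : ZMod 2 × ZMod 2) :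
    pauliForm n v (Pi.single i a) = (v i).1 * a.2 + (v i).2 * a.1 := by
  rw [pauliForm_apply, Finset.sum_eq_single i]
  · simp
  · intro j _ hj; simp [Pi.single_eq_of_ne hj]
  · simp

theorem pauliForm_single_left (i : Fin n) (a : ZMod 2 × ZMod 2) (v : Fin n → ZMod 2 × ZMod 2) :
    pauliForm n (Pi.single i a) v = a.1 * (v i).2 + a.2 * (v i).1 := by
  rw [pauliForm_apply, Finset.sum_eq_single i]
  · simp
  · intro j _ hj; simp [Pi.single_eq_of_ne hj]
  · simp

theorem pauliForm_separatingLeft : (pauliForm n).SeparatingLeft := by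
  intro v hv
  funext i
  have h1 := hv (Pi.single i (0, 1))
  have h2 := hv (Pi.single i (1, 0))
  rw [pauliForm_single_right] at h1 h2
  exact Prod.ext (by simpa using h1) (by simpa using h2)

theorem pauliForm_nondegenerate : (pauliForm n).Nondegenerate :=
  (pauliForm_isAlt.isRefl.nondegenerate_iff_separatingLeft).2 pauliForm_separatingLeft

theorem pauliOp_mul (v w : Fin n → ZMod 2 × ZMod 2) :
    pauliOp v * pauliOp w = binarySign (∑ i, (v i).2 * (w i).1) • pauliOp (v + w) := by
  simp only [pauliOp, qubitTensor_mul, pauliOne_mul, qubitTensor_smul, binarySign_sum]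
  rfl

/-- The two orders differ by the quotient of their reordering signs, which is the sign of the form;
form value 1 thus means anticommuting. -/
theorem pauliOp_mul_comm (v w : Fin n → ZMod 2 × ZMod 2) :
    pauliOp v * pauliOp w = binarySign (pauliForm n v w) • (pauliOp w * pauliOp v) := by
  rw [pauliOp_mul, pauliOp_mul, smul_smul, ← binarySign_add, pauliForm_apply, add_comm w v,
    Finset.sum_add_distrib]
  congr 2
  have h : ∑ i, (w i).2 * (v i).1 = ∑ i, (v i).1 * (w i).2 := by simp only [mul_comm]
  rw [h, add_comm _ (∑ i, (v i).2 * (w i).1), add_assoc, CharTwo.add_self_eq_zero, add_zero]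

theorem pauliOp_zero : pauliOp (0 : Fin n → ZMod 2 × ZMod 2) = 1 := by
  rw [← qubitTensor_one, pauliOp]; simp

theorem pauliOp_mul_self (v : Fin n → ZMod 2 × ZMod 2) :
    pauliOp v * pauliOp v = binarySign (∑ i, (v i).2 * (v i).1) • 1 := by
  have h : v + v = 0 := by
    funext i
    exact Prod.ext (CharTwo.add_self_eq_zero _) (CharTwo.add_self_eq_zero _)
  rw [pauliOp_mul, h, pauliOp_zero]

theorem pauliOp_mem_unitaryGroup (v : Fin n → ZMod 2 × ZMod 2) :
    pauliOp v ∈ Matrix.unitaryGroup (Fin n → Fin 2) ℂ :=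
  qubitTensor_mem_unitaryGroup fun _ => pauliOne_mem_unitaryGroup _

theorem pauliOp_ne_zero (v : Fin n → ZMod 2 × ZMod 2) : pauliOp v ≠ 0 := by
  intro h
  have := pauliOp_mul_self v
  rw [h, zero_mul, eq_comm, smul_eq_zero] at this
  exact this.elim (binarySign_ne_zero _) one_ne_zero

/-- Proportional Pauli operators have equal labels. -/
theorem eq_of_pauliOp_eq_smul {v w : Fin n → ZMod 2 × ZMod 2} {c : ℂ}
    (h : pauliOp v = c • pauliOp w) : v = w := by
  have hc : c ≠ 0 := by
    rintro rfl
    exact pauliOp_ne_zero v (by simpa using h)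
  rw [← sub_eq_zero]
  -- Proportional operators have the same commutation sign with every `pauliOp u`, so `v - w` lies
  -- in the radical.
  refine pauliForm_separatingLeft _ fun u => ?_
  have h1 := pauliOp_mul_comm v u
  rw [h, smul_mul_assoc, pauliOp_mul_comm w u, mul_smul_comm, smul_smul, smul_smul] at h1
  have h2 : pauliOp u * pauliOp w ≠ 0 := by
    rw [pauliOp_mul]
    exact smul_ne_zero (binarySign_ne_zero _) (pauliOp_ne_zero _)
  have h3 := smul_left_injective ℂ h2 h1
  rw [mul_comm] at h3
  rw [map_sub, LinearMap.sub_apply, ← binarySign_injective (mul_right_cancel₀ hc h3), sub_self]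

/-- An operator commuting with all Pauli operators is a scalar. -/
theorem exists_eq_smul_one_of_commute {M : Matrix (Fin n → Fin 2) (Fin n → Fin 2) ℂ}
    (hM : ∀ v, M * pauliOp v = pauliOp v * M) : ∃ c : ℂ, M = c • 1 := by
  -- Commuting with `Z_j` kills entries between strings that differ at `j`.
  have hd : ∀ s t, s ≠ t → M s t = 0 := by
    intro s t hst
    obtain ⟨j, hj⟩ := Function.ne_iff.1 hst
    have hz : (pauliOp (Pi.single j (0, 1)) : Matrix (Fin n → Fin 2) (Fin n → Fin 2) ℂ) =
        Matrix.diagonal fun s => if s j = 0 then 1 else -1 := by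
      ext s t
      rw [Matrix.diagonal_apply, pauliOp, qubitTensor_apply]
      split_ifs with h h'
      · subst h
        refine Finset.prod_eq_one fun i _ => ?_
        by_cases hi : i = j
        · subst hi; simp [h']
        · simp [Pi.single_eq_of_ne hi]
      · subst h
        rw [Finset.prod_eq_single j]
        · have : s j = 1 := by omega
          simp [this]
        · intro i _ hi; simp [Pi.single_eq_of_ne hi]
        · simp
      · obtain ⟨i, hi⟩ := Function.ne_iff.1 h
        refine Finset.prod_eq_zero (Finset.mem_univ i) ?_
        by_cases hi' : i = j
        · subst hi'
          have : (s i = 0 ∧ t i = 1) ∨ (s i = 1 ∧ t i = 0) := by omega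
          rcases this with ⟨h1, h2⟩ | ⟨h1, h2⟩ <;> simp [h1, h2]
        · simp [Pi.single_eq_of_ne hi', Matrix.one_apply_ne hi]
    have h := congrFun (congrFun (hM (Pi.single j (0, 1))) s) t
    rw [hz, Matrix.mul_diagonal, Matrix.diagonal_mul] at h
    have : (s j = 0 ∧ t j = 1) ∨ (s j = 1 ∧ t j = 0) := by omega
    rcases this with ⟨h1, h2⟩ | ⟨h1, h2⟩ <;> simp [h1, h2] at h <;>
      first
        | linear_combination (1 / 2) * h
        | linear_combination (-1 / 2) * h
  -- Commuting with the `X`-string that exchanges `s` and `t` equates the two diagonal entries.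
  have hs : ∀ s t, M s s = M t t := by
    intro s t
    set v : Fin n → ZMod 2 × ZMod 2 := fun i => if s i = t i then (0, 0) else (1, 0) with hv
    have hx : pauliOp v s t = 1 := by
      rw [pauliOp, qubitTensor_apply]
      refine Finset.prod_eq_one fun i _ => ?_
      by_cases hi : s i = t i
      · simp [hv, hi]
      · have : (s i = 0 ∧ t i = 1) ∨ (s i = 1 ∧ t i = 0) := by omega
        rcases this with ⟨h1, h2⟩ | ⟨h1, h2⟩ <;> simp [hv, h1, h2]
    have h := congrFun (congrFun (hM v) s) t
    rw [Matrix.mul_apply, Matrix.mul_apply, Finset.sum_eq_single s, Finset.sum_eq_single t, hx,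
      mul_one, one_mul] at h
    · exact h
    · intro u _ hu; rw [hd _ _ hu, mul_zero]
    · simp
    · intro u _ hu; rw [hd _ _ hu.symm, zero_mul]
    · simp
  refine ⟨M 0 0, ?_⟩
  ext s t
  by_cases h : s = t
  · subst h; simp [hs s 0]
  · simp [h, hd]

end Pauli

/-! ### Generation of the symplectic group over `ZMod 2` by transvections -/

section Transvection

variable {V : Type*} [AddCommGroup V] [Module (ZMod 2) V] {B : LinearMap.BilinForm (ZMod 2) V}

theorem add_self_eq_zero_of_zmod_two (v : V) : v + v = 0 := by
  rw [← two_smul (ZMod 2) v, show (2 : ZMod 2) = 0 from rfl, zero_smul]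

theorem LinearMap.BilinForm.IsAlt.comm_of_zmod_two (hB : B.IsAlt) (v w : V) : B v w = B w v := by
  rw [← LinearMap.IsAlt.neg hB, ZMod.neg_eq_self_mod_two]

theorem transvection_isometry (hB : B.IsAlt) (u v w : V) :
    B (LinearMap.transvection (B u) u v) (LinearMap.transvection (B u) u w) = B v w := by
  simp only [LinearMap.transvection.apply, map_add, map_smul, LinearMap.add_apply,
    LinearMap.smul_apply, smul_eq_mul, hB u, hB.comm_of_zmod_two v u]
  linear_combination CharTwo.add_self_eq_zero (B u v * B u w)

theorem transvection_mul_self (hB : B.IsAlt) (u : V) :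
    LinearMap.transvection (B u) u * LinearMap.transvection (B u) u = 1 := by
  ext v
  simp only [Module.End.mul_apply, LinearMap.transvection.apply, map_add, map_smul, hB u,
    Module.End.one_apply]
  linear_combination (norm := module) add_self_eq_zero_of_zmod_two (B u v • u)

/-- Here `B (u + v) u = 1`, so `u + v` is added to `u`. Together with the next lemma this moves one
vector while fixing others. -/
theorem transvection_add_apply (hB : B.IsAlt) {u v : V} (h : B u v = 1) :
    LinearMap.transvection (B (u + v)) (u + v) u = v := by
  rw [LinearMap.transvection.apply, map_add, LinearMap.add_apply, hB u, zero_add,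
    hB.comm_of_zmod_two, h, one_smul, ← add_assoc, add_self_eq_zero_of_zmod_two, zero_add]

theorem transvection_add_apply_of_eq (hB : B.IsAlt) {u v s : V} (h : B s u = B s v) :
    LinearMap.transvection (B (u + v)) (u + v) s = s := by
  rw [LinearMap.transvection.apply, map_add, LinearMap.add_apply, hB.comm_of_zmod_two u,
    hB.comm_of_zmod_two v, h, CharTwo.add_self_eq_zero, zero_smul, add_zero]

/-- Conjugating the transvection along `v` by the one along `w` gives the one along `v + w`. -/
theorem transvection_add_eq (hB : B.IsAlt) {v w : V} (h : B v w = 1) :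
    LinearMap.transvection (B (v + w)) (v + w) =
      LinearMap.transvection (B w) w * LinearMap.transvection (B v) v *
        LinearMap.transvection (B w) w := by
  have h' : B w v = 1 := by rw [hB.comm_of_zmod_two, h]
  ext x
  simp only [Module.End.mul_apply, LinearMap.transvection.apply, map_add, map_smul, hB w,
    LinearMap.add_apply, h, h']
  have e := add_self_eq_zero_of_zmod_two (B w x • w)
  linear_combination (norm := module) -e

/-- Products of transvections act transitively on vectors, relative to a fixed subspace. -/
theorem exists_transvections_map_eq [FiniteDimensional (ZMod 2) V] (hB : B.IsAlt)
    (hB' : B.Nondegenerate) {S : Submonoid (Module.End (ZMod 2) V)}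
    (hS : ∀ v, LinearMap.transvection (B v) v ∈ S) (F : Submodule (ZMod 2) V) {u v : V}
    (hu : u ∉ F) (hv : v ∉ F) (huv : ∀ s ∈ F, B s u = B s v) :
    ∃ τ ∈ S, ∃ τ' ∈ S, τ' * τ = 1 ∧ (∀ x y, B (τ x) (τ y) = B x y) ∧ (∀ s ∈ F, τ s = s) ∧
      τ u = v := by
  rcases zmod_two_eq_zero_or_one (B u v) with h | h
  -- When `B u v = 0` the transvection along `u + v` fixes `u`, so the route is `u ↦ u + w' ↦ v`,
  -- with `w'` orthogonal to `F` and pairing to 1 with both `u` and `v`. A functional with these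
  -- values exists because `u` lies outside `F` enlarged by `u + v`; nondegeneracy turns it into
  -- `w'`.
  · have hu' : u ∉ F ⊔ Submodule.span (ZMod 2) {u + v} := by
      intro hmem
      obtain ⟨f, hf, y, hy, e⟩ := Submodule.mem_sup.1 hmem
      obtain ⟨a, rfl⟩ := Submodule.mem_span_singleton.1 hy
      rcases zmod_two_eq_zero_or_one a with rfl | rfl
      · rw [zero_smul, add_zero] at e
        exact hu (e ▸ hf)
      · have hfv : f = v := by
          have e1 := add_self_eq_zero_of_zmod_two v
          linear_combination (norm := module) e - e1
        exact hv (hfv ▸ hf)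
    obtain ⟨g, hgu, hg⟩ := Submodule.exists_le_ker_of_notMem hu'
    have hgu1 : g u = 1 := (zmod_two_eq_zero_or_one _).resolve_left hgu
    have hgv : g v = 1 := by
      have : g (u + v) = 0 :=
        hg (Submodule.mem_sup_right (Submodule.mem_span_singleton_self _))
      rw [map_add, hgu1] at this
      linear_combination this - CharTwo.add_self_eq_zero (1 : ZMod 2)
    obtain ⟨w', rfl⟩ := (B.toDual hB').surjective g
    rw [LinearMap.BilinForm.toDual_def] at hgu1 hgv
    have hw' : ∀ s ∈ F, B s w' = 0 := fun s hs => by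
      rw [hB.comm_of_zmod_two, ← LinearMap.BilinForm.toDual_def hB']
      exact hg (Submodule.mem_sup_left hs)
    have huw : B u (u + w') = 1 := by
      rw [map_add, hB u, zero_add, hB.comm_of_zmod_two, hgu1]
    have hwv : B (u + w') v = 1 := by
      rw [map_add, LinearMap.add_apply, h, zero_add, hgv]
    have hsw : ∀ s ∈ F, B s (u + w') = B s u := fun s hs => by
      rw [map_add, hw' s hs, add_zero]
    refine ⟨_, S.mul_mem (hS (u + w' + v)) (hS (u + (u + w'))), _,
      S.mul_mem (hS (u + (u + w'))) (hS (u + w' + v)), ?_, ?_, ?_, ?_⟩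
    · rw [mul_assoc, ← mul_assoc (LinearMap.transvection (B (u + w' + v)) _),
        transvection_mul_self hB, one_mul, transvection_mul_self hB]
    · intro x y
      simp only [Module.End.mul_apply, transvection_isometry hB]
    · intro s hs
      rw [Module.End.mul_apply, transvection_add_apply_of_eq hB (hsw s hs).symm,
        transvection_add_apply_of_eq hB ((hsw s hs).trans (huv s hs))]
    · rw [Module.End.mul_apply, transvection_add_apply hB huw, transvection_add_apply hB hwv]
  · exact ⟨_, hS (u + v), _, hS (u + v), transvection_mul_self hB _, transvection_isometry hB _,
      fun s hs => transvection_add_apply_of_eq hB (huv s hs), transvection_add_apply hB h⟩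

/-- Over `ZMod 2`, the isometries of a nondegenerate alternating form are generated by
transvections. -/
theorem mem_of_isometry [FiniteDimensional (ZMod 2) V] (hB : B.IsAlt)
    (hB' : B.Nondegenerate) {S : Submonoid (Module.End (ZMod 2) V)}
    (hS : ∀ v, LinearMap.transvection (B v) v ∈ S) {σ : Module.End (ZMod 2) V}
    (hσ : ∀ x y, B (σ x) (σ y) = B x y) : σ ∈ S := by
  -- Induction on the codimension of the fixed space: a product of transvections sends `σ b` back to
  -- `b` and keeps every fixed vector, so the fixed space grows.
  induction hd : Module.finrank (ZMod 2) V - Module.finrank (ZMod 2) (LinearMap.ker (σ - 1))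
    using Nat.strong_induction_on generalizing σ with
  | _ d ih =>
  have hinj : ∀ x, σ x = 0 → x = 0 := fun x hx => hB'.1 x fun y => by
    rw [← hσ, hx, map_zero, LinearMap.zero_apply]
  have hker : ∀ (ρ : Module.End (ZMod 2) V) x, x ∈ LinearMap.ker (ρ - 1) ↔ ρ x = x := fun ρ x => by
    rw [LinearMap.mem_ker, LinearMap.sub_apply, Module.End.one_apply, sub_eq_zero]
  by_cases htop : LinearMap.ker (σ - 1) = ⊤
  · have : σ = 1 := by
      ext x
      exact (hker σ x).1 (htop ▸ Submodule.mem_top)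
    exact this ▸ S.one_mem
  obtain ⟨b, hb⟩ : ∃ b, b ∉ LinearMap.ker (σ - 1) := by
    by_contra! h
    exact htop ((Submodule.eq_top_iff').2 h)
  have hσb : σ b ∉ LinearMap.ker (σ - 1) := by
    intro h
    rw [hker] at h hb
    refine hb (sub_eq_zero.1 (hinj _ ?_))
    rw [map_sub, h, sub_self]
  obtain ⟨τ, hτ, τ', hτ', hττ', hiso, hfix, hmap⟩ :=
    exists_transvections_map_eq hB hB' hS _ hσb hb fun s hs => by
      rw [← hσ s b, (hker σ s).1 hs]
  have hlt : LinearMap.ker (σ - 1) < LinearMap.ker (τ * σ - 1) := by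
    refine lt_of_le_of_ne (fun s hs => ?_) fun h => hb ?_
    · have := (hker σ s).1 hs
      rw [hker, Module.End.mul_apply, this, hfix s hs]
    · rw [h, hker, Module.End.mul_apply, hmap]
  have h1 := Submodule.finrank_lt_finrank_of_lt hlt
  have h2 := Submodule.finrank_le (LinearMap.ker (τ * σ - 1))
  have h3 := ih _ (by omega) (σ := τ * σ)
    (fun x y => by rw [Module.End.mul_apply, Module.End.mul_apply, hiso, hσ]) rfl
  have h4 := S.mul_mem hτ' h3
  rwa [← mul_assoc, hττ', one_mul] at h4

end Transvection

/-! ### Generating all Pauli labels along a connected graph -/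

section Support

variable {n : ℕ}

/-- A family of finite sets containing the singletons and the edges of a connected graph and closed
under symmetric differences retaining one common point contains every nonempty set. -/
theorem SimpleGraph.Connected.mem_of_symmDiff_closed {ι : Type*} [DecidableEq ι]
    {Γ : SimpleGraph ι} (hΓ : Γ.Connected) {S : Set (Finset ι)}
    (hS : ∀ s ∈ S, ∀ t ∈ S, ∀ i ∈ s, i ∈ t → insert i (symmDiff s t) ∈ S)
    (h1 : ∀ i, {i} ∈ S) (h2 : ∀ i j, Γ.Adj i j → {i, j} ∈ S) (s : Finset ι) (hs : s.Nonempty) :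
    s ∈ S := by
  -- Along a walk, `{i, k}` and `{k, l}` combine at `k` to `{i, k, l}`, which combines with `{i, k}`
  -- at `i` to `{i, l}`.
  have hpair : ∀ i j, {i, j} ∈ S := by
    intro i j
    have h := (SimpleGraph.reachable_iff_reflTransGen i j).1 (hΓ.preconnected i j)
    induction h with
    | refl => simpa using h1 i
    | @tail k l _ hkl ih =>
      by_cases hik : i = k
      · subst hik; exact h2 _ _ hkl
      by_cases hil : i = l
      · subst hil; simpa using h1 i
      have hkl' := hkl.ne
      have h3 := hS _ ih _ (h2 _ _ hkl) k (by simp) (by simp)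
      have h4 := hS _ h3 _ ih i (by simp [Finset.mem_symmDiff]; tauto) (by simp)
      convert h4 using 1
      ext x
      simp only [Finset.mem_insert, Finset.mem_singleton, Finset.mem_symmDiff]
      have := Ne.symm hik
      have := hkl'.symm
      by_cases x = i <;> by_cases x = k <;> by_cases x = l <;> simp_all
  induction s using Finset.induction_on with
  | empty => simp at hs
  | insert k s hk ih =>
    rcases s.eq_empty_or_nonempty with rfl | hne
    · simpa using h1 k
    obtain ⟨i, hi⟩ := hne
    have h3 := hS _ (ih ⟨i, hi⟩) _ (hpair i k) i hi (by simp)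
    convert h3 using 1
    ext x
    simp only [Finset.mem_insert, Finset.mem_singleton, Finset.mem_symmDiff]
    by_cases hxi : x = i
    · subst hxi; simp [hi]
    · by_cases hxk : x = k
      · subst hxk; simp [hk]
      · simp [hxi, hxk]

/-- A set of Pauli vectors, closed under sums of anticommuting pairs, that contains all
single-qubit vectors and one vector on each edge of a connected graph, contains every nonzero
vector. -/
theorem mem_of_anticommuting_closed {Γ : SimpleGraph (Fin n)} (hΓ : Γ.Connected)
    {T : Set (Fin n → ZMod 2 × ZMod 2)}
    (hT : ∀ v ∈ T, ∀ w ∈ T, pauliForm n v w = 1 → v + w ∈ T)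
    (h1 : ∀ i a, a ≠ 0 → Pi.single i a ∈ T)
    (h2 : ∀ i j, Γ.Adj i j → Pi.single i (0, 1) + Pi.single j (0, 1) ∈ T)
    (v : Fin n → ZMod 2 × ZMod 2) (hv : v ≠ 0) : v ∈ T := by
  -- Two distinct nonzero one-qubit labels sum to the third, which anticommutes with both; adding it
  -- at `i` turns `v i` into `a`. So membership in `T` depends only on the support.
  have hupd : ∀ v ∈ T, ∀ i a, v i ≠ 0 → a ≠ 0 → Function.update v i a ∈ T := by
    intro v hv i a hvi ha
    by_cases hva : v i = a
    · rwa [← hva, Function.update_eq_self]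
    · have key : ∀ a b : ZMod 2 × ZMod 2, a ≠ 0 → b ≠ 0 → a ≠ b →
          a + b ≠ 0 ∧ a.1 * (a + b).2 + a.2 * (a + b).1 = 1 ∧ a + (a + b) = b := by
        simp only [forall_pauliVec]
        simp [show (1 + 1 : ZMod 2) = 0 from rfl]
      obtain ⟨k1, k2, k3⟩ := key _ _ hvi ha hva
      have := hT v hv _ (h1 i _ k1) (by rw [pauliForm_single_right, k2])
      convert this using 1
      funext j
      by_cases hj : j = i
      · subst hj; simp [k3]
      · simp [hj]
  have hsupp : ∀ v ∈ T, ∀ w : Fin n → ZMod 2 × ZMod 2, (∀ i, v i = 0 ↔ w i = 0) → w ∈ T := by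
    intro v hv w hvw
    have : ∀ s : Finset (Fin n), s.piecewise w v ∈ T := by
      intro s
      induction s using Finset.induction_on with
      | empty => simpa using hv
      | insert i s hi ih =>
        rw [Finset.piecewise_insert]
        by_cases hw : w i = 0
        · convert ih using 1
          rw [Function.update_eq_self_iff, Finset.piecewise_eq_of_notMem _ _ _ hi, hw,
            (hvw i).2 hw]
        · exact hupd _ ih i _ (by
            rw [Finset.piecewise_eq_of_notMem _ _ _ hi]
            exact fun h => hw ((hvw i).1 h)) hw
    simpa using this Finset.univ
  set S : Set (Finset (Fin n)) := {s |
    ∀ v : Fin n → ZMod 2 × ZMod 2, (∀ i, v i ≠ 0 ↔ i ∈ s) → v ∈ T}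
    with hSdef
  have hmem : ∀ v ∈ T, ∀ s : Finset (Fin n), (∀ i, v i ≠ 0 ↔ i ∈ s) → s ∈ S := by
    intro v hv s hs w hw
    exact hsupp v hv w fun i => not_iff_not.1 ((hs i).trans (hw i).symm)
  have hall := hΓ.mem_of_symmDiff_closed (S := S) ?_ ?_ ?_ (Finset.univ.filter fun i => v i ≠ 0)
    (by
      obtain ⟨i, hi⟩ := Function.ne_iff.1 hv
      exact ⟨i, by simpa using hi⟩)
  · exact hall v (by simp)
  · intro s hs t ht i his hit
    -- Take `Z` throughout `s`, and `Z` throughout `t` except `X` at `i`: they anticommute exactly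
    -- at `i`, and elsewhere on `s ∩ t` the sum cancels.
    have hp := hs (fun j => if j ∈ s then (0, 1) else 0) (by intro j; split_ifs <;> simp_all)
    have hq := ht (fun j => if j = i then (1, 0) else if j ∈ t then (0, 1) else 0) (by
      intro j; split_ifs <;> simp_all)
    refine hmem _ (hT _ hp _ hq ?_) _ ?_
    · rw [pauliForm_apply, Finset.sum_eq_single i]
      · simp [his]
      · intro j _ hj
        simp only [hj, if_false]
        split_ifs <;> simp
      · simp
    · intro j
      by_cases hj : j = i
      · subst hj; simp [his]
      · by_cases hjs : j ∈ s <;> by_cases hjt : j ∈ t <;>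
          simp [hj, hjs, hjt, Finset.mem_symmDiff, show (1 + 1 : ZMod 2) = 0 from rfl]
  · intro i
    refine hmem _ (h1 i (0, 1) (by simp)) _ fun j => ?_
    by_cases hj : j = i
    · subst hj; simp
    · simp [hj]
  · intro i j hij
    refine hmem _ (h2 i j hij) _ fun k => ?_
    have := hij.ne
    by_cases hk : k = i
    · subst hk; simp [this]
    · by_cases hk' : k = j
      · subst hk'; simp [hk]
      · simp [hk, hk']

end Support

/-! ### The action of unitaries on Pauli labels -/

section Action

variable {n : ℕ}

/-- Conjugation by `U` permutes the Pauli operators up to scalars as `σ` permutes their labels. -/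
def ActsAs (U : QubitUnitary n)
    (σ : (Fin n → ZMod 2 × ZMod 2) → (Fin n → ZMod 2 × ZMod 2)) : Prop :=
  ∀ v, ∃ c : ℂ, U.1 * pauliOp v * U.1ᴴ = c • pauliOp (σ v)

theorem coe_mul_conjTranspose (U : QubitUnitary n) : U.1 * U.1ᴴ = 1 :=
  Matrix.mem_unitaryGroup_iff.1 U.2

theorem conjTranspose_mul_coe (U : QubitUnitary n) : U.1ᴴ * U.1 = 1 :=
  Matrix.mem_unitaryGroup_iff'.1 U.2

theorem ActsAs.one : ActsAs (1 : QubitUnitary n) id := fun v => ⟨1, by simp⟩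

theorem ActsAs.mul {U U' : QubitUnitary n} {σ τ} (h : ActsAs U σ) (h' : ActsAs U' τ) :
    ActsAs (U * U') (σ ∘ τ) := by
  intro v
  obtain ⟨c, hc⟩ := h' v
  obtain ⟨d, hd⟩ := h (τ v)
  refine ⟨c * d, ?_⟩
  calc (U * U').1 * pauliOp v * (U * U').1ᴴ
      = U.1 * (U'.1 * pauliOp v * U'.1ᴴ) * U.1ᴴ := by
        rw [Submonoid.coe_mul, Matrix.conjTranspose_mul]; simp only [Matrix.mul_assoc]
    _ = _ := by
        rw [hc, Matrix.mul_smul, Matrix.smul_mul, hd, smul_smul]; rfl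

theorem conj_cancel (U : QubitUnitary n) (M : Matrix (Fin n → Fin 2) (Fin n → Fin 2) ℂ) :
    U.1ᴴ * (U.1 * M * U.1ᴴ) * U.1 = M := by
  calc U.1ᴴ * (U.1 * M * U.1ᴴ) * U.1 = U.1ᴴ * U.1 * M * (U.1ᴴ * U.1) := by
        simp only [Matrix.mul_assoc]
    _ = M := by rw [conjTranspose_mul_coe, one_mul, mul_one]

theorem conj_ne_zero (U : QubitUnitary n) (v : Fin n → ZMod 2 × ZMod 2) :
    U.1 * pauliOp v * U.1ᴴ ≠ 0 := by
  intro h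
  apply pauliOp_ne_zero v
  rw [← conj_cancel U (pauliOp v), h, mul_zero, zero_mul]

theorem conj_mul_conj (U : QubitUnitary n) (M N : Matrix (Fin n → Fin 2) (Fin n → Fin 2) ℂ) :
    U.1 * M * U.1ᴴ * (U.1 * N * U.1ᴴ) = U.1 * (M * N) * U.1ᴴ := by
  calc U.1 * M * U.1ᴴ * (U.1 * N * U.1ᴴ) = U.1 * M * (U.1ᴴ * U.1) * N * U.1ᴴ := by
        simp only [Matrix.mul_assoc]
    _ = _ := by rw [conjTranspose_mul_coe]; simp only [Matrix.mul_assoc, Matrix.one_mul]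

theorem pauliOp_pow_four (v : Fin n → ZMod 2 × ZMod 2) : pauliOp v ^ 4 = 1 := by
  rw [show 4 = 2 * 2 from rfl, pow_mul, pow_two (pauliOp v), pauliOp_mul_self, smul_pow, one_pow,
    pow_two, binarySign_mul_self, one_smul]

/-- Conjugation preserves fourth powers, which are 1 for Pauli operators; hence the phase stays
within the powers of `i`. -/
theorem pow_four_eq_one_of_conj {U : QubitUnitary n} {v w : Fin n → ZMod 2 × ZMod 2} {c : ℂ}
    (h : U.1 * pauliOp v * U.1ᴴ = c • pauliOp w) : c ^ 4 = 1 := by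
  have h1 : (c • pauliOp w) ^ 4 = 1 := by
    rw [← h, show 4 = 2 * 2 from rfl, pow_mul, pow_two (U.1 * pauliOp v * U.1ᴴ), conj_mul_conj,
      pow_two, conj_mul_conj,
      show pauliOp v * pauliOp v * (pauliOp v * pauliOp v) = pauliOp v ^ 4 by
        simp only [pow_succ, pow_zero, one_mul, mul_assoc], pauliOp_pow_four, mul_one,
      coe_mul_conjTranspose]
  rw [smul_pow, pauliOp_pow_four] at h1
  simpa using congrFun (congrFun h1 0) 0

theorem exists_eq_I_pow {c : ℂ} (h : c ^ 4 = 1) : ∃ q : Fin 4, c = Complex.I ^ (q : ℕ) := by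
  have h1 : (c - 1) * ((c + 1) * ((c - Complex.I) * (c + Complex.I))) = 0 := by
    linear_combination h + (1 - c ^ 2) * Complex.I_sq
  rcases mul_eq_zero.1 h1 with h2 | h2
  · exact ⟨0, by simpa using sub_eq_zero.1 h2⟩
  rcases mul_eq_zero.1 h2 with h2 | h2
  · exact ⟨2, by simpa using eq_neg_of_add_eq_zero_left h2⟩
  rcases mul_eq_zero.1 h2 with h2 | h2
  · exact ⟨1, by simpa using sub_eq_zero.1 h2⟩
  · refine ⟨3, ?_⟩
    rw [eq_neg_of_add_eq_zero_left h2]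
    exact Complex.I_pow_three.symm

theorem mem_pauliGroup_iff {P : QubitUnitary n} :
    P ∈ pauliGroup n ↔ ∃ c : ℂ, c ^ 4 = 1 ∧ ∃ v, P.1 = c • pauliOp v := by
  constructor
  · rintro ⟨q, r, r', h⟩
    refine ⟨_, ?_, fun i => (r i, r' i), h.trans (by rw [xString_mul_zString])⟩
    rw [← pow_mul, mul_comm, pow_mul, Complex.I_pow_four, one_pow]
  · rintro ⟨c, hc, v, h⟩
    obtain ⟨q, rfl⟩ := exists_eq_I_pow hc
    exact ⟨q, _, _, h.trans (by rw [pauliOp_eq_xString_mul_zString])⟩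

theorem coe_conj (U P : QubitUnitary n) : (U * P * U⁻¹).1 = U.1 * P.1 * U.1ᴴ := rfl

/-- Normalizing is an equivalence; surjectivity of `σ` supplies the direction from `U P U⁻¹` back to
`P`. -/
theorem ActsAs.mem_cliffordGroup {U : QubitUnitary n} {σ} (h : ActsAs U σ)
    (hσ : Function.Surjective σ) : U ∈ cliffordGroup n := by
  rw [cliffordGroup, Subgroup.mem_set_normalizer_iff]
  intro P
  simp only [mem_pauliGroup_iff, coe_conj]
  constructor
  · rintro ⟨c, hc, v, hP⟩
    obtain ⟨d, hd⟩ := h v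
    refine ⟨c * d, by rw [mul_pow, hc, pow_four_eq_one_of_conj hd, one_mul], σ v, ?_⟩
    rw [hP, Matrix.mul_smul, Matrix.smul_mul, hd, smul_smul]
  · rintro ⟨c, hc, w, hP⟩
    obtain ⟨v, rfl⟩ := hσ w
    obtain ⟨d, hd⟩ := h v
    have hd4 := pow_four_eq_one_of_conj hd
    have hd0 : d ≠ 0 := by rintro rfl; simp at hd4
    refine ⟨c * d⁻¹, by rw [mul_pow, hc, inv_pow, hd4, inv_one, one_mul], v, ?_⟩
    rw [← conj_cancel U P.1, hP, ← conj_cancel U (pauliOp v), hd, Matrix.mul_smul, Matrix.smul_mul,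
      Matrix.mul_smul, Matrix.smul_mul, smul_smul, mul_assoc c, inv_mul_cancel₀ hd0, mul_one]

/-- A Clifford unitary acts on Pauli labels. -/
theorem exists_actsAs_of_mem_cliffordGroup {U : QubitUnitary n} (hU : U ∈ cliffordGroup n) :
    ∃ σ, ActsAs U σ := by
  rw [cliffordGroup, Subgroup.mem_set_normalizer_iff] at hU
  have h : ∀ v, ∃ w, ∃ c : ℂ, U.1 * pauliOp v * U.1ᴴ = c • pauliOp w := by
    intro v
    obtain ⟨c, -, w, h⟩ := mem_pauliGroup_iff.1 ((hU ⟨pauliOp v, pauliOp_mem_unitaryGroup v⟩).1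
      (mem_pauliGroup_iff.2 ⟨1, one_pow 4, v, (one_smul _ _).symm⟩))
    exact ⟨w, c, h⟩
  choose σ hσ using h
  exact ⟨σ, hσ⟩

/-- The action of a unitary on Pauli labels is linear and preserves the symplectic form. -/
theorem ActsAs.exists_isometry {U : QubitUnitary n} {σ} (h : ActsAs U σ) :
    ∃ τ : Module.End (ZMod 2) (Fin n → ZMod 2 × ZMod 2), (τ : _ → _) = σ ∧
      ∀ v w, pauliForm n (τ v) (τ w) = pauliForm n v w := by
  choose c hc using h
  have hc0 : ∀ v, c v ≠ 0 := fun v h0 => conj_ne_zero U v (by rw [hc, h0, zero_smul])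
  -- Conjugation is multiplicative; forgetting phases leaves additivity of labels.
  have hadd : ∀ v w, σ (v + w) = σ v + σ w := by
    intro v w
    have h1 := conj_mul_conj U (pauliOp v) (pauliOp w)
    rw [hc, hc, pauliOp_mul v w, Matrix.mul_smul U.1, Matrix.smul_mul _ _ U.1ᴴ, hc,
      smul_mul_smul_comm, pauliOp_mul,
      smul_smul, smul_smul] at h1
    have h2 := congrArg (fun M => (binarySign (∑ i, (v i).2 * (w i).1) * c (v + w))⁻¹ • M) h1
    simp only [smul_smul] at h2
    rw [inv_mul_cancel₀ (mul_ne_zero (binarySign_ne_zero _) (hc0 _)), one_smul] at h2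
    exact eq_of_pauliOp_eq_smul h2.symm
  refine ⟨(AddMonoidHom.mk' σ hadd).toZModLinearMap 2, rfl, fun v w => ?_⟩
  change pauliForm n (σ v) (σ w) = _
  have h1 := conj_mul_conj U (pauliOp v) (pauliOp w)
  rw [pauliOp_mul_comm v w, Matrix.mul_smul, Matrix.smul_mul, ← conj_mul_conj, hc, hc,
    smul_mul_smul_comm, smul_mul_smul_comm, pauliOp_mul_comm, smul_smul, smul_smul] at h1
  have h2 : pauliOp (σ w) * pauliOp (σ v) ≠ 0 := by
    rw [pauliOp_mul]
    exact smul_ne_zero (binarySign_ne_zero _) (pauliOp_ne_zero _)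
  have h3 := smul_left_injective ℂ h2 h1
  refine binarySign_injective (mul_left_cancel₀ (mul_ne_zero (hc0 v) (hc0 w)) ?_)
  linear_combination h3

theorem ActsAs.inv {U : QubitUnitary n} {σ τ} (h : ActsAs U σ) (hτ : Function.RightInverse τ σ) :
    ActsAs U⁻¹ τ := by
  intro v
  obtain ⟨c, hc⟩ := h (τ v)
  have hc0 : c ≠ 0 := fun h0 => conj_ne_zero U (τ v) (by rw [hc, h0, zero_smul])
  refine ⟨c⁻¹, ?_⟩
  rw [← conj_cancel U (pauliOp (τ v)), hc, hτ v, Matrix.mul_smul, Matrix.smul_mul, smul_smul,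
    inv_mul_cancel₀ hc0, one_smul, Matrix.UnitaryGroup.inv_val, Matrix.star_eq_conjTranspose,
    Matrix.conjTranspose_conjTranspose]

/-- A unitary fixing all Pauli labels is a scalar multiple of a Pauli operator. -/
theorem ActsAs.exists_eq_smul_pauliOp {U : QubitUnitary n} (h : ActsAs U id) :
    ∃ (c : ℂ) (u : Fin n → ZMod 2 × ZMod 2), U.1 = c • pauliOp u := by
  choose c hc using h
  simp only [id] at hc
  -- The phases form a character of the label group, with values ±1 since `v + v = 0`. The form
  -- represents it by some `u`, so `U` and `pauliOp u` have the same commutation signs and their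
  -- product is scalar.
  have hmul : ∀ v w, c (v + w) = c v * c w := by
    intro v w
    have h1 := conj_mul_conj U (pauliOp v) (pauliOp w)
    rw [hc, hc, pauliOp_mul v w, Matrix.mul_smul U.1, Matrix.smul_mul _ _ U.1ᴴ, hc,
      smul_mul_smul_comm, pauliOp_mul, smul_smul, smul_smul] at h1
    have h2 := smul_left_injective ℂ (pauliOp_ne_zero _) h1
    refine mul_left_cancel₀ (binarySign_ne_zero (∑ i, (v i).2 * (w i).1)) ?_
    linear_combination -h2
  have h0 : c 0 = 1 := by
    have h1 := hc 0
    rw [pauliOp_zero, mul_one, coe_mul_conjTranspose] at h1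
    simpa using (congrFun (congrFun h1 0) 0).symm
  have hsign : ∀ v, ∃ a, c v = binarySign a := by
    intro v
    have h1 := hmul v v
    rw [add_self_eq_zero_of_zmod_two, h0] at h1
    rcases mul_self_eq_one_iff.1 h1.symm with h2 | h2
    · exact ⟨0, by simpa using h2⟩
    · exact ⟨1, by simpa using h2⟩
  choose f hf using hsign
  have hadd : ∀ v w, f (v + w) = f v + f w := fun v w => binarySign_injective (by
    rw [binarySign_add, ← hf, ← hf, ← hf, hmul])
  obtain ⟨u, hu⟩ := ((pauliForm n).toDual pauliForm_nondegenerate).surjective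
    ((AddMonoidHom.mk' f hadd).toZModLinearMap 2)
  have hu' : ∀ v, pauliForm n u v = f v := fun v => by
    rw [← LinearMap.BilinForm.toDual_def pauliForm_nondegenerate, hu]; rfl
  have hcomm : ∀ v, U.1 * pauliOp v = c v • (pauliOp v * U.1) := fun v => by
    rw [← Matrix.smul_mul, ← hc, Matrix.mul_assoc _ _ U.1, conjTranspose_mul_coe, mul_one]
  obtain ⟨k, hk⟩ := exists_eq_smul_one_of_commute (M := pauliOp u * U.1) fun v => by
    rw [Matrix.mul_assoc, hcomm, Matrix.mul_smul, ← Matrix.mul_assoc, pauliOp_mul_comm, hu',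
      Matrix.smul_mul, smul_smul, hf, binarySign_mul_self, one_smul, Matrix.mul_assoc]
  refine ⟨binarySign (∑ i, (u i).2 * (u i).1) * k, u, ?_⟩
  have h1 : pauliOp u * (pauliOp u * U.1) = k • pauliOp u := by
    rw [hk, Matrix.mul_smul, mul_one]
  rw [← Matrix.mul_assoc, pauliOp_mul_self, Matrix.smul_mul, one_mul] at h1
  rw [mul_smul, ← h1, smul_smul, binarySign_mul_self, one_smul]

end Action

/-! ### Layers of one-qubit Clifford gates -/

section LocalLayer

variable {n : ℕ}

/-- The tensor product of one-qubit unitaries. -/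
def tensorUnitary (m : Fin n → Matrix (Fin 2) (Fin 2) ℂ)
    (hm : ∀ i, m i ∈ Matrix.unitaryGroup (Fin 2) ℂ) : QubitUnitary n :=
  ⟨qubitTensor m, qubitTensor_mem_unitaryGroup hm⟩

/-- The symplectic matrix with diagonal blocks `α`, `β`, `γ`, `δ`. -/
def diagonalSp (α β γ δ : Fin n → ZMod 2) (h : ∀ i, α i * δ i + β i * γ i = 1) : BinarySp n :=
  ⟨Matrix.fromBlocks (Matrix.diagonal α) (Matrix.diagonal β) (Matrix.diagonal γ)
    (Matrix.diagonal δ), by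
    rw [SymplecticGroup.mem_iff, Matrix.J, Matrix.fromBlocks_transpose, Matrix.fromBlocks_multiply,
      Matrix.fromBlocks_multiply]
    simp only [Matrix.diagonal_transpose, mul_zero, zero_add, add_zero, mul_neg, mul_one,
      Matrix.diagonal_mul_diagonal, Matrix.diagonal_neg, Matrix.diagonal_add,
      ← Matrix.diagonal_one, ← Matrix.diagonal_zero, Matrix.fromBlocks_inj]
    refine ⟨?_, ?_, ?_, ?_⟩ <;> congr 1 <;> funext i <;>
      simp only [ZMod.neg_eq_self_mod_two]
    · linear_combination CharTwo.add_self_eq_zero (α i * β i)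
    · linear_combination h i
    · linear_combination h i
    · linear_combination CharTwo.add_self_eq_zero (γ i * δ i)⟩

/-- Being represented by `A` means acting on Pauli labels through the blocks of `A`. -/
theorem represents_iff_actsAs {U : QubitUnitary n} {A : BinarySp n} :
    Represents U A ↔ ActsAs U fun v i =>
      ((A.1.toBlocks₁₁ *ᵥ (fun j => (v j).1) + A.1.toBlocks₁₂ *ᵥ fun j => (v j).2) i,
        (A.1.toBlocks₂₁ *ᵥ (fun j => (v j).1) + A.1.toBlocks₂₂ *ᵥ fun j => (v j).2) i) := by
  constructor
  · intro h v
    obtain ⟨c, hc⟩ := h (fun j => (v j).1) fun j => (v j).2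
    rw [xString_mul_zString, xString_mul_zString] at hc
    exact ⟨c, hc⟩
  · intro h r r'
    obtain ⟨c, hc⟩ := h fun i => (r i, r' i)
    rw [xString_mul_zString, xString_mul_zString]
    exact ⟨c, hc⟩

theorem actsAs_tensorUnitary {m : Fin n → Matrix (Fin 2) (Fin 2) ℂ}
    (hm : ∀ i, m i ∈ Matrix.unitaryGroup (Fin 2) ℂ)
    {σ : Fin n → ZMod 2 × ZMod 2 → ZMod 2 × ZMod 2}
    (h : ∀ i a, ∃ c : ℂ, m i * pauliOne a * (m i)ᴴ = c • pauliOne (σ i a)) :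
    ActsAs (tensorUnitary m hm) fun v i => σ i (v i) := by
  intro v
  choose c hc using h
  refine ⟨∏ i, c i (v i), ?_⟩
  simp only [tensorUnitary, pauliOp, qubitTensor_conjTranspose, qubitTensor_mul, hc,
    qubitTensor_smul]

theorem represents_diagonalSp {m : Fin n → Matrix (Fin 2) (Fin 2) ℂ}
    (hm : ∀ i, m i ∈ Matrix.unitaryGroup (Fin 2) ℂ) {α β γ δ : Fin n → ZMod 2}
    (hdet : ∀ i, α i * δ i + β i * γ i = 1)
    (h : ∀ i a, ∃ c : ℂ, m i * pauliOne a * (m i)ᴴ =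
      c • pauliOne (α i * a.1 + β i * a.2, γ i * a.1 + δ i * a.2)) :
    Represents (tensorUnitary m hm) (diagonalSp α β γ δ hdet) := by
  rw [represents_iff_actsAs]
  have := actsAs_tensorUnitary hm
    (σ := fun i a => (α i * a.1 + β i * a.2, γ i * a.1 + δ i * a.2)) h
  simpa only [diagonalSp, Matrix.toBlocks_fromBlocks₁₁, Matrix.toBlocks_fromBlocks₁₂,
    Matrix.toBlocks_fromBlocks₂₁, Matrix.toBlocks_fromBlocks₂₂, Pi.add_apply,
    Matrix.mulVec_diagonal] using this

theorem isSCL_tensorUnitary {m : Fin n → Matrix (Fin 2) (Fin 2) ℂ}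
    (hm : ∀ i, m i ∈ Matrix.unitaryGroup (Fin 2) ℂ) {α β γ δ : Fin n → ZMod 2}
    (hdet : ∀ i, α i * δ i + β i * γ i = 1)
    (h : ∀ i a, ∃ c : ℂ, m i * pauliOne a * (m i)ᴴ =
      c • pauliOne (α i * a.1 + β i * a.2, γ i * a.1 + δ i * a.2)) :
    IsSCL (tensorUnitary m hm) (diagonalSp α β γ δ hdet) := by
  refine ⟨represents_diagonalSp hm hdet h, fun j => tensorUnitary (fun _ => m j) fun _ => hm j,
    fun j => diagonalSp (fun _ => α j) (fun _ => β j) (fun _ => γ j) (fun _ => δ j) fun _ => hdet j,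
    fun j => ?_, fun j => represents_diagonalSp _ _ fun _ => h j, ?_, ?_⟩
  · refine (actsAs_tensorUnitary (fun _ => hm j)
      (σ := fun _ a => (α j * a.1 + β j * a.2, γ j * a.1 + δ j * a.2))
        fun _ => h j).mem_cliffordGroup fun w => ?_
    -- Inverse of a 2 × 2 matrix of determinant 1 in characteristic 2.
    refine ⟨fun i => (δ j * (w i).1 + β j * (w i).2, γ j * (w i).1 + α j * (w i).2), ?_⟩
    funext i
    have h1 := hdet j
    have h2 := CharTwo.add_self_eq_zero (α j * β j * (w i).2)
    have h3 := CharTwo.add_self_eq_zero (γ j * δ j * (w i).1)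
    ext
    · simp only
      linear_combination (w i).1 * h1 + h2
    · simp only
      linear_combination (w i).2 * h1 + h3
  · change qubitTensor m = _
    congr 1
    funext j
    ext a b
    simp [oneQubitMatrix, tensorUnitary, qubitTensor_apply]
  · simp [diagonalSp]

end LocalLayer

/-! ### Identity, Pauli, phase and square-root-of-`X` layers -/

section Gates

variable {n : ℕ}

theorem isSCL_one : ∃ B, IsSCL (1 : QubitUnitary n) B := by
  have h := isSCL_tensorUnitary (m := fun _ : Fin n => 1) (fun _ => one_mem _)
    (α := 1) (β := 0) (γ := 0) (δ := 1) (by simp) (fun i a => ⟨1, by simp⟩)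
  have e : tensorUnitary (fun _ : Fin n => 1) (fun _ => one_mem _) = 1 :=
    Subtype.ext qubitTensor_one
  exact ⟨_, e ▸ h⟩

/-- A unitary proportional to a Pauli operator is a layer of one-qubit Clifford gates. -/
theorem isSCL_of_eq_smul_pauliOp (hn : 0 < n) {U : QubitUnitary n} {c : ℂ}
    {u : Fin n → ZMod 2 × ZMod 2} (hU : U.1 = c • pauliOp u) : ∃ B, IsSCL U B := by
  have hc : c * star c = 1 := by
    have h := coe_mul_conjTranspose U
    have h' : pauliOp u * (pauliOp u)ᴴ = 1 :=
      Matrix.mem_unitaryGroup_iff.1 (pauliOp_mem_unitaryGroup u)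
    rw [hU, Matrix.conjTranspose_smul, smul_mul_smul_comm, h'] at h
    simpa using congrFun (congrFun h 0) 0
  -- The global phase is absorbed into the first tensor factor.
  have hphase : ∀ i : Fin n,
      (if i = ⟨0, hn⟩ then c else 1) * star (if i = ⟨0, hn⟩ then c else 1) = 1 := by
    intro i
    split_ifs
    · exact hc
    · simp
  have hone : ∀ a, pauliOne a * (pauliOne a)ᴴ = 1 := fun a =>
    Matrix.mem_unitaryGroup_iff.1 (pauliOne_mem_unitaryGroup a)
  have hm : ∀ i,
      (if i = ⟨0, hn⟩ then c else 1) • pauliOne (u i) ∈ Matrix.unitaryGroup (Fin 2) ℂ := by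
    intro i
    rw [Matrix.mem_unitaryGroup_iff, Matrix.star_eq_conjTranspose, Matrix.conjTranspose_smul,
      smul_mul_smul_comm, hphase, hone, one_smul]
  have h := isSCL_tensorUnitary hm (α := 1) (β := 0) (γ := 0) (δ := 1) (by simp) (fun i a =>
    ⟨binarySign ((u i).2 * a.1) * binarySign (a.2 * (u i).1), by
      have hcomm : pauliOne (u i) * pauliOne a =
          (binarySign ((u i).2 * a.1) * binarySign (a.2 * (u i).1)) •
            (pauliOne a * pauliOne (u i)) := by
        rw [pauliOne_mul, pauliOne_mul, smul_smul, add_comm a, mul_assoc, binarySign_mul_self,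
          mul_one]
      rw [Matrix.conjTranspose_smul, Matrix.smul_mul, Matrix.smul_mul, Matrix.mul_smul, smul_smul,
        hphase, one_smul, hcomm, Matrix.smul_mul, Matrix.mul_assoc, hone, mul_one]
      simp⟩)
  have e : tensorUnitary _ hm = U := Subtype.ext (by
    refine (qubitTensor_smul _ _).trans ?_
    rw [hU, Finset.prod_ite_eq' Finset.univ]
    simp [pauliOp])
  exact ⟨_, e ▸ h⟩

/-- A gate on qubit `j` that acts on one-qubit Pauli labels as the transvection along `b` gives a
layer acting as the transvection along `b` at `j`. -/
theorem exists_isSCL_transvection (j : Fin n) {M : Matrix (Fin 2) (Fin 2) ℂ}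
    (hM : M ∈ Matrix.unitaryGroup (Fin 2) ℂ) {b : ZMod 2 × ZMod 2} (hb : b.1 * b.2 = 0)
    (h : ∀ a, ∃ c : ℂ, M * pauliOne a * Mᴴ = c • pauliOne (a + (b.1 * a.2 + b.2 * a.1) • b)) :
    ∃ V B, IsSCL (n := n) V B ∧
      ActsAs V (LinearMap.transvection (pauliForm n (Pi.single j b)) (Pi.single j b)) := by
  have hm : ∀ i, (if i = j then M else 1) ∈ Matrix.unitaryGroup (Fin 2) ℂ := by
    intro i
    split_ifs
    · exact hM
    · exact one_mem _
  have hconj : ∀ i a, ∃ c : ℂ, (if i = j then M else 1) * pauliOne a * (if i = j then M else 1)ᴴ =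
      c • pauliOne (if i = j then a + (b.1 * a.2 + b.2 * a.1) • b else a) := by
    intro i a
    split_ifs
    · exact h a
    · exact ⟨1, by simp⟩
  -- Since `b.1 * b.2 = 0`, the one-qubit transvection along `b` has unit diagonal and off-diagonal
  -- entries `b.1`, `b.2`.
  refine ⟨tensorUnitary _ hm, diagonalSp 1 (Pi.single j b.1) (Pi.single j b.2) 1 ?_,
    isSCL_tensorUnitary hm _ ?_, ?_⟩
  · intro i
    by_cases hi : i = j
    · subst hi; simp [hb]
    · simp [hi]
  · intro i a
    obtain ⟨c, hc⟩ := hconj i a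
    refine ⟨c, hc.trans ?_⟩
    congr 2
    by_cases hi : i = j
    · subst hi
      obtain ⟨b1, b2⟩ := b
      have hsq : ∀ x : ZMod 2, x * x = x := by decide
      have h1 := hsq b1
      have h2 := hsq b2
      ext
      · simp only [if_true, Prod.fst_add, Prod.smul_fst, Pi.one_apply, Pi.single_eq_same,
          smul_eq_mul]
        linear_combination a.2 * h1 + a.1 * hb
      · simp only [if_true, Prod.snd_add, Prod.smul_snd, Pi.one_apply, Pi.single_eq_same,
          smul_eq_mul]
        linear_combination a.1 * h2 + a.2 * hb
    · simp [hi]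
  · convert actsAs_tensorUnitary hm
      (σ := fun i a => if i = j then a + (b.1 * a.2 + b.2 * a.1) • b else a) hconj using 1
    funext v i
    rw [LinearMap.transvection.apply, pauliForm_single_left]
    by_cases hi : i = j
    · subst hi
      simp only [Pi.add_apply, Pi.smul_apply, Pi.single_eq_same, if_true]
    · simp [hi]

/-- The phase gate acts as the transvection along `Z_j`. -/
theorem exists_isSCL_transvection_z (j : Fin n) :
    ∃ V B, IsSCL (n := n) V B ∧
      ActsAs V (LinearMap.transvection (pauliForm n (Pi.single j (0, 1)))
        (Pi.single j (0, 1))) := by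
  have hs : (1 + 1 : ZMod 2) = 0 := rfl
  refine exists_isSCL_transvection j (M := !![1, 0; 0, Complex.I]) ?_ (by simp) ?_
  · rw [Matrix.mem_unitaryGroup_iff, Matrix.star_eq_conjTranspose]
    ext i j; fin_cases i <;> fin_cases j <;> simp [Matrix.mul_apply]
  · simp only [forall_pauliVec]
    -- The phase gate sends `X` to `i XZ` and `XZ` to `i X`.
    refine ⟨⟨1, ?_⟩, ⟨1, ?_⟩, ⟨Complex.I, ?_⟩, ⟨Complex.I, ?_⟩⟩ <;> ext i j <;> fin_cases i <;>
      fin_cases j <;> simp [Matrix.mul_apply, hs]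

/-- The square root of `X` acts as the transvection along `X_j`. -/
theorem exists_isSCL_transvection_x (j : Fin n) :
    ∃ V B, IsSCL (n := n) V B ∧
      ActsAs V (LinearMap.transvection (pauliForm n (Pi.single j (1, 0)))
        (Pi.single j (1, 0))) := by
  have hs : (1 + 1 : ZMod 2) = 0 := rfl
  refine exists_isSCL_transvection j (M := !![(1 + Complex.I) / 2, (1 - Complex.I) / 2;
    (1 - Complex.I) / 2, (1 + Complex.I) / 2]) ?_ (by simp) ?_
  · rw [Matrix.mem_unitaryGroup_iff, Matrix.star_eq_conjTranspose]
    ext i j; fin_cases i <;> fin_cases j <;> simp [Matrix.mul_apply, map_ofNat] <;>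
      ring_nf <;> simp only [Complex.I_sq] <;> norm_num
  · simp only [forall_pauliVec]
    refine ⟨⟨1, ?_⟩, ⟨-Complex.I, ?_⟩, ⟨1, ?_⟩, ⟨-Complex.I, ?_⟩⟩ <;> ext i j <;> fin_cases i <;>
      fin_cases j <;> simp [Matrix.mul_apply, hs, map_ofNat] <;> ring_nf <;> 
      (try simp [Complex.I_sq]) <;> (try ring_nf)

end Gates

/-! ### Controlled-`Z` layers -/

section ControlledZ

variable {n : ℕ}

open Classical in
/-- The symplectic matrix of the layer of controlled-`Z` gates along the edges of `Γ`. -/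
def graphSp (Γ : SimpleGraph (Fin n)) : BinarySp n :=
  ⟨Matrix.fromBlocks 1 0 (Γ.adjMatrix (ZMod 2)) 1, by
    rw [SymplecticGroup.mem_iff, Matrix.J, Matrix.fromBlocks_transpose, Matrix.fromBlocks_multiply,
      Matrix.fromBlocks_multiply]
    simp⟩

theorem exists_isCZL_bot : ∃ G, IsCZL (⊥ : SimpleGraph (Fin n)) 1 G := by
  refine ⟨graphSp ⊥, ?_, ?_, by rw [graphSp]⟩
  · rw [represents_iff_actsAs]
    convert ActsAs.one (n := n) using 1
    funext v i
    simp [graphSp]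
  · simp [czProduct]

theorem czGate_mem_unitaryGroup (i j : Fin n) :
    czGate i j ∈ Matrix.unitaryGroup (Fin n → Fin 2) ℂ := by
  rw [Matrix.mem_unitaryGroup_iff, Matrix.star_eq_conjTranspose, czGate,
    Matrix.diagonal_conjTranspose, Matrix.diagonal_mul_diagonal, ← Matrix.diagonal_one]
  congr 1
  funext s
  rw [Pi.star_apply]
  split_ifs <;> simp

theorem czProduct_edge {i j : Fin n} (h : i < j) :
    czProduct (SimpleGraph.edge i j) = czGate i j := by
  refine (Finset.noncommProd_congr (s₂ := {(i, j)}) (Finset.ext ?_) (fun _ _ => rfl) _).trans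
    (Finset.noncommProd_singleton _ _)
  rintro ⟨a, b⟩
  simp only [Finset.mem_filter, Finset.mem_univ, true_and, SimpleGraph.edge_adj,
    Finset.mem_singleton, Prod.mk.injEq]
  constructor
  · rintro ⟨hab, (h' | ⟨rfl, rfl⟩), -⟩
    · exact h'
    · exact absurd hab h.not_gt
  · rintro ⟨rfl, rfl⟩
    exact ⟨h, by simp, h.ne⟩

/-- Conjugating a two-qubit Pauli operator by a controlled-`Z` gate, entry by entry. -/
theorem cz_entry (a b : ZMod 2 × ZMod 2) (s s' t t' : Fin 2) :
    (if s = 1 ∧ s' = 1 then -1 else 1) * (pauliOne a s t * pauliOne b s' t') *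
      (if t = 1 ∧ t' = 1 then -1 else 1) = binarySign (a.1 * b.1) *
        (pauliOne (a + (0, b.1)) s t * pauliOne (b + (0, a.1)) s' t') := by
  have hs : (1 + 1 : ZMod 2) = 0 := rfl
  revert a b
  simp only [forall_pauliVec]
  revert s s' t t'
  simp only [Fin.forall_fin_two]
  simp [hs]

/-- Only the tensor factors at `i` and `j` matter, so `cz_entry` decides: an `X` on either qubit
acquires a `Z` on the other. -/
theorem actsAs_czGate {i j : Fin n} (hij : i ≠ j) :
    ActsAs ⟨czGate i j, czGate_mem_unitaryGroup i j⟩ fun v =>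
      v + Pi.single i (0, (v j).1) + Pi.single j (0, (v i).1) := by
  intro v
  refine ⟨binarySign ((v i).1 * (v j).1), ?_⟩
  have hsplit : ∀ f : Fin n → ℂ, ∏ k, f k = f i * f j * ∏ k ∈ {i, j}ᶜ, f k := fun f => by
    rw [← Finset.prod_mul_prod_compl {i, j}, Finset.prod_pair hij]
  have hct : (czGate i j)ᴴ = czGate i j := by
    rw [czGate, Matrix.diagonal_conjTranspose]
    congr 1
    funext s
    rw [Pi.star_apply]
    split_ifs <;> simp
  ext s t
  simp only [hct]
  rw [czGate, Matrix.mul_diagonal, Matrix.diagonal_mul, Matrix.smul_apply, pauliOp, pauliOp,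
    qubitTensor_apply, qubitTensor_apply, hsplit, hsplit]
  have h1 : ∏ k ∈ ({i, j} : Finset (Fin n))ᶜ, pauliOne ((v + Pi.single i (0, (v j).1) +
      Pi.single j (0, (v i).1) : Fin n → ZMod 2 × ZMod 2) k) (s k) (t k) =
        ∏ k ∈ {i, j}ᶜ, pauliOne (v k) (s k) (t k) := by
    refine Finset.prod_congr rfl fun k hk => ?_
    simp only [Finset.mem_compl, Finset.mem_insert, Finset.mem_singleton, not_or] at hk
    simp [hk.1, hk.2]
  rw [h1, smul_eq_mul]
  have h2 := cz_entry (v i) (v j) (s i) (s j) (t i) (t j)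
  simp only [Pi.add_apply, Pi.single_eq_same, Pi.single_eq_of_ne hij, Pi.single_eq_of_ne hij.symm,
    add_zero]
  linear_combination (∏ k ∈ {i, j}ᶜ, pauliOne (v k) (s k) (t k)) * h2

theorem exists_isCZL_edge {i j : Fin n} (hij : i < j) :
    ∃ W G, IsCZL (SimpleGraph.edge i j) W G ∧ ActsAs W fun v =>
      v + Pi.single i (0, (v j).1) + Pi.single j (0, (v i).1) := by
  refine ⟨⟨czGate i j, czGate_mem_unitaryGroup i j⟩, graphSp _,
    ⟨?_, (czProduct_edge hij).symm, rfl⟩,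
    actsAs_czGate hij.ne⟩
  rw [represents_iff_actsAs]
  convert actsAs_czGate hij.ne using 1
  funext v k
  have hadj : ∀ (_ : DecidableRel (SimpleGraph.edge i j).Adj) (r : Fin n → ZMod 2),
      ((SimpleGraph.edge i j).adjMatrix (ZMod 2) *ᵥ r) k =
      (Pi.single i (r j) + Pi.single j (r i) : Fin n → ZMod 2) k := by
    intro _ r
    have hne := hij.ne
    rw [Matrix.mulVec, dotProduct]
    simp only [SimpleGraph.adjMatrix_apply, SimpleGraph.edge_adj, ite_mul, one_mul, zero_mul]
    by_cases hk : k = i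
    · subst hk
      rw [Finset.sum_eq_single j]
      · simp [hne]
      · intro l _ hl; simp [hl, hne]
      · simp
    · by_cases hk' : k = j
      · subst hk'
        rw [Finset.sum_eq_single i]
        · simp [hne.symm]
        · intro l _ hl; simp [hl, hne.symm]
        · simp
      · simp [hk, hk']
  have hsingle : ∀ (l : Fin n) (x : ZMod 2),
      (Pi.single l (0, x) : Fin n → ZMod 2 × ZMod 2) k =
        (0, (Pi.single l x : Fin n → ZMod 2) k) := by
    intro l x
    by_cases hk : k = l
    · subst hk; simp
    · rw [Pi.single_eq_of_ne hk, Pi.single_eq_of_ne hk]; rfl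
  simp only [graphSp, Matrix.toBlocks_fromBlocks₁₁, Matrix.toBlocks_fromBlocks₁₂,
    Matrix.toBlocks_fromBlocks₂₁, Matrix.toBlocks_fromBlocks₂₂, Pi.add_apply, Matrix.one_mulVec,
    Matrix.zero_mulVec, Pi.zero_apply, hsingle]
  ext
  · simp
  · simp only [Prod.snd_add]
    rw [hadj, Pi.add_apply]
    ring

end ControlledZ

/-! ### Circuits and the transvections they realize -/

section Circuits

variable {n : ℕ}

/-- Alternating products of one-qubit Clifford layers and controlled-`Z` layers along subgraphs
of `Γcon`. -/
def IsLayered (Γcon : SimpleGraph (Fin n)) (U : QubitUnitary n) : Prop :=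
  ∃ (l : ℕ) (B : Fin (l + 1) → BinarySp n) (G : Fin l → BinarySp n)
    (Γ : Fin l → SimpleGraph (Fin n)) (V : Fin (l + 1) → QubitUnitary n)
    (W : Fin l → QubitUnitary n),
    (∀ i, IsSCL (V i) (B i)) ∧ (∀ i, IsCZL (Γ i) (W i) (G i)) ∧ (∀ i, Γ i ≤ Γcon) ∧
      U = alternatingProduct V W

theorem IsLayered.layer_mul {Γcon Γ' : SimpleGraph (Fin n)} {U V' W' : QubitUnitary n}
    {B' G' : BinarySp n} (hU : IsLayered Γcon U) (hV : IsSCL V' B') (hW : IsCZL Γ' W' G')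
    (hΓ : Γ' ≤ Γcon) : IsLayered Γcon (V' * (W' * U)) := by
  obtain ⟨l, B, G, Γ, V, W, h1, h2, h3, rfl⟩ := hU
  refine ⟨l + 1, Fin.snoc B B', Fin.snoc G G', Fin.snoc Γ Γ', Fin.snoc V V', Fin.snoc W W',
    ?_, ?_, ?_, ?_⟩
  · intro i
    refine Fin.lastCases ?_ (fun i => ?_) i
    · simpa using hV
    · simpa using h1 i
  · intro i
    refine Fin.lastCases ?_ (fun i => ?_) i
    · simpa using hW
    · simpa using h2 i
  · intro i
    refine Fin.lastCases ?_ (fun i => ?_) i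
    · simpa using hΓ
    · simpa using h3 i
  · simp only [alternatingProduct, Fin.snoc_last, Fin.snoc_castSucc]
    rw [List.ofFn_succ' (n := l), List.concat_eq_append, List.reverse_append]
    simp [mul_assoc, Fin.snoc_castSucc]

/-- The circuits built from one-qubit Clifford layers and controlled-`Z` layers along subgraphs
of `Γcon`. -/
def circuits (Γcon : SimpleGraph (Fin n)) : Submonoid (QubitUnitary n) :=
  Submonoid.closure ({V | ∃ B, IsSCL V B} ∪ {W | ∃ Γ ≤ Γcon, ∃ G, IsCZL Γ W G})

theorem isLayered_of_mem_circuits {Γcon : SimpleGraph (Fin n)} {U : QubitUnitary n}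
    (hU : U ∈ circuits Γcon) : IsLayered Γcon U := by
  obtain ⟨B₁, hB₁⟩ := isSCL_one (n := n)
  obtain ⟨G₁, hG₁⟩ := exists_isCZL_bot (n := n)
  induction hU using Submonoid.closure_induction_left with
  | one =>
    exact ⟨0, fun _ => B₁, Fin.elim0, Fin.elim0, fun _ => 1, Fin.elim0, fun _ => hB₁,
      fun i => i.elim0, fun i => i.elim0, by simp [alternatingProduct]⟩
  -- The missing partner of each generator is an identity layer: an empty CZ layer or a trivial
  -- single-qubit layer.
  | mul_left x hx y hy ih =>
    rcases hx with ⟨B, hB⟩ | ⟨Γ, hΓ, G, hG⟩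
    · simpa using ih.layer_mul hB hG₁ bot_le
    · simpa using ih.layer_mul hB₁ hG hΓ

/-- The linear maps on Pauli labels realized by circuits. -/
def circuitActions (Γcon : SimpleGraph (Fin n)) :
    Submonoid (Module.End (ZMod 2) (Fin n → ZMod 2 × ZMod 2)) where
  carrier := {σ | ∃ C ∈ circuits Γcon, ActsAs C σ}
  one_mem' := ⟨1, one_mem _, ActsAs.one⟩
  mul_mem' := by
    rintro σ τ ⟨C, hC, hσ⟩ ⟨D, hD, hτ⟩
    exact ⟨C * D, mul_mem hC hD, hσ.mul hτ⟩

/-- The transvection adds `x_i + x_j` to both `z_i` and `z_j`. The CZ contributes the cross terms,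
the phase gates the terms `x_i` in `z_i` and `x_j` in `z_j`. -/
theorem transvection_single_add_single_eq {i j : Fin n} (hij : i ≠ j) :
    LinearMap.transvection (pauliForm n (Pi.single i (0, 1) + Pi.single j (0, 1)))
        (Pi.single i (0, 1) + Pi.single j (0, 1)) =
      fun v : Fin n → ZMod 2 × ZMod 2 =>
        LinearMap.transvection (pauliForm n (Pi.single i (0, 1))) (Pi.single i (0, 1))
        (LinearMap.transvection (pauliForm n (Pi.single j (0, 1))) (Pi.single j (0, 1))
          (v + Pi.single i (0, (v j).1) + Pi.single j (0, (v i).1))) := by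
  funext v k
  simp only [LinearMap.transvection.apply, map_add, LinearMap.add_apply, pauliForm_single_left]
  by_cases hi : k = i
  · subst hi
    ext <;> simp [hij, hij.symm]
    ring
  · by_cases hj : k = j
    · subst hj
      ext <;> simp [hij, hij.symm]
      ring
    · simp [hi, hj]

theorem transvection_mem_circuitActions {Γcon : SimpleGraph (Fin n)} (hcon : Γcon.Connected)
    (v : Fin n → ZMod 2 × ZMod 2) :
    LinearMap.transvection (pauliForm n v) v ∈ circuitActions Γcon := by
  have hlocal : ∀ {σ : Module.End (ZMod 2) (Fin n → ZMod 2 × ZMod 2)},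
      (∃ V B, IsSCL V B ∧ ActsAs V σ) → σ ∈ circuitActions Γcon := by
    rintro σ ⟨V, B, hV, hσ⟩
    exact ⟨V, Submonoid.subset_closure (Or.inl ⟨B, hV⟩), hσ⟩
  have hx := fun j => hlocal (exists_isSCL_transvection_x (n := n) j)
  have hz := fun j => hlocal (exists_isSCL_transvection_z (n := n) j)
  have hadd : ∀ v ∈ {v | LinearMap.transvection (pauliForm n v) v ∈ circuitActions Γcon},
      ∀ w ∈ {v | LinearMap.transvection (pauliForm n v) v ∈ circuitActions Γcon},
      pauliForm n v w = 1 →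
        v + w ∈ {v | LinearMap.transvection (pauliForm n v) v ∈ circuitActions Γcon} := by
    intro v hv w hw hvw
    rw [Set.mem_ofPred_eq, transvection_add_eq pauliForm_isAlt hvw]
    exact mul_mem (mul_mem hw hv) hw
  by_cases hv : v = 0
  · subst hv
    convert one_mem (circuitActions Γcon) using 1
    refine LinearMap.ext fun x => ?_
    simp
  refine mem_of_anticommuting_closed hcon hadd ?_ ?_ v hv
  · intro i
    rw [forall_pauliVec]
    refine ⟨fun h => absurd rfl h, fun _ => hz i, fun _ => hx i, fun _ => ?_⟩
    -- `X_i` and `Z_i` anticommute, which gives the third one-qubit label.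
    have := hadd _ (hx i) _ (hz i) (by simp [pauliForm_single_right])
    rwa [← Pi.single_add, Prod.mk_add_mk, add_zero, zero_add] at this
  · have hlt : ∀ i j, i < j → Γcon.Adj i j → (Pi.single i (0, 1) + Pi.single j (0, 1)) ∈
        {v | LinearMap.transvection (pauliForm n v) v ∈ circuitActions Γcon} := by
      intro i j hij hadj
      obtain ⟨W, G, hW, hact⟩ := exists_isCZL_edge hij
      obtain ⟨C, hC, hCσ⟩ := hz i
      obtain ⟨D, hD, hDσ⟩ := hz j
      refine ⟨C * (D * W), mul_mem hC (mul_mem hD (Submonoid.subset_closure (Or.inr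
        ⟨_, (SimpleGraph.edge_le_iff _).2 (Or.inr hadj), G, hW⟩))), ?_⟩
      rw [transvection_single_add_single_eq hij.ne]
      exact hCσ.mul (hDσ.mul hact)
    intro i j hadj
    rcases lt_or_gt_of_ne hadj.ne with h | h
    · exact hlt i j h hadj
    · rw [add_comm]; exact hlt j i h hadj.symm

end Circuits

end

theorem lemma1 (n : ℕ) (Γcon : SimpleGraph (Fin n)) (hcon : Γcon.Connected)
    (U : QubitUnitary n) (hU : U ∈ cliffordGroup n) :
    ∃ (l : ℕ) (B : Fin (l + 1) → BinarySp n) (G : Fin l → BinarySp n)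
      (Γ : Fin l → SimpleGraph (Fin n))
      (V : Fin (l + 1) → QubitUnitary n) (W : Fin l → QubitUnitary n),
      (∀ i, IsSCL (V i) (B i)) ∧
      (∀ i, IsCZL (Γ i) (W i) (G i)) ∧
      (∀ i, Γ i ≤ Γcon) ∧
      U = alternatingProduct V W := by
  have hn : 0 < n := Fin.pos_iff_nonempty.2 hcon.nonempty
  obtain ⟨σ, hσ⟩ := exists_actsAs_of_mem_cliffordGroup hU
  obtain ⟨τ, rfl, hτ⟩ := hσ.exists_isometry
  obtain ⟨C, hC, hCτ⟩ := mem_of_isometry pauliForm_isAlt pauliForm_nondegenerate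
    (transvection_mem_circuitActions hcon) hτ
  have hinj : Function.Injective τ := by
    rw [injective_iff_map_eq_zero]
    intro v hv
    refine pauliForm_separatingLeft v fun w => ?_
    rw [← hτ, hv, map_zero, LinearMap.zero_apply]
  have hsurj : Function.Surjective τ := LinearMap.injective_iff_surjective.1 hinj
  have hinv := hCτ.inv (Function.rightInverse_surjInv hsurj)
  -- `C` has the same label action as `U`, so only a Pauli operator and a phase remain.
  have hid : ActsAs (U * C⁻¹) id := by
    have := hσ.mul hinv
    rwa [(Function.rightInverse_surjInv hsurj).comp_eq_id] at this
  obtain ⟨c, u, hcu⟩ := hid.exists_eq_smul_pauliOp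
  obtain ⟨B, hB⟩ := isSCL_of_eq_smul_pauliOp hn hcu
  refine isLayered_of_mem_circuits (U := U) ?_
  rw [← inv_mul_cancel_right U C]
  exact mul_mem (Submonoid.subset_closure (Or.inl ⟨B, hB⟩)) hC
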